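/- Let $\mathbb K$ be $\mathbb R$ or $\mathbb C$. A pair $(X,Y)$ of Banach spaces over $\mathbb K$ is called a Banach couple if both spaces are linearly and continuously embedded into some Hausdorff topological vector space. Write $X\cap Y$ and $X+Y$ for the intersection and the sum, with the norms $\|z\|_{X\cap Y}=\max\{\|z\|_X,\|z\|_Y\}$ and $\|z\|_{X+Y}=\inf\{\|x\|_X+\|y\|_Y : x\in X,\ y\in Y,\ z=x+y\}$. An interpolation space for $(X,Y)$ is a Banach space $Z$ such that $X\cap Y\subset Z\subset X+Y$ linearly with continuous inclusions, and $T(Z)\subset Z$ for every linear operator $T\colon X+Y\to X+Y$ that maps $X$ into $X$ and $Y$ into $Y$ boundedly. Let $\mathrm{Int}(X,Y)$ denote the collection of all interpolation spaces for $(X,Y)$. For Banach spaces, $E\simeq F$ means that $E$ and $F$ coincide as linear spaces and their norms are equivalent. Corollary 2.9. Let $(X,Y)$ and $(V,W)$ be two Banach couples with $$\mathrm{Int}(X,Y)=\mathrm{Int}(V,W).$$ Then either $X\simeq V$ and $Y\simeq W$, or $X\simeq W$ and $Y\simeq V$. -/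

import Mathlib

/-- A Banach space over `𝕜` whose underlying linear space is a linear subspace `carrier` of the
(untopologized) linear space `E`, with a complete norm `nrm` of its own. -/
structure BanachSubspace (𝕜 E : Type*) [RCLike 𝕜] [AddCommGroup E] [Module 𝕜 E] where
  /-- the underlying linear space -/
  carrier : Submodule 𝕜 E
  /-- the norm; it is definite by the next field -/
  nrm : Seminorm 𝕜 carrier
  eq_zero_of_nrm_eq_zero : ∀ x : carrier, nrm x = 0 → x = 0
  complete : @CompleteSpace carrier
    nrm.toAddGroupSeminorm.toSeminormedAddCommGroup.toPseudoMetricSpace.toUniformSpace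

namespace BanachSubspace

variable {𝕜 E : Type*} [RCLike 𝕜] [AddCommGroup E] [Module 𝕜 E]

/-- The norm topology of a Banach space `X ⊆ E`. -/
abbrev normTopology (X : BanachSubspace 𝕜 E) : TopologicalSpace X.carrier :=
  X.nrm.toAddGroupSeminorm.toSeminormedAddCommGroup.toPseudoMetricSpace.toUniformSpace.toTopologicalSpace

/-- `X ≃ Y`: the spaces coincide as linear spaces and their norms are equivalent. -/
def Equivalent (X Y : BanachSubspace 𝕜 E) : Prop :=
  X.carrier = Y.carrier ∧
    ∃ C : ℝ, ∀ (x : E) (hX : x ∈ X.carrier) (hY : x ∈ Y.carrier),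
      X.nrm ⟨x, hX⟩ ≤ C * Y.nrm ⟨x, hY⟩ ∧ Y.nrm ⟨x, hY⟩ ≤ C * X.nrm ⟨x, hX⟩

end BanachSubspace

/-- A Banach couple `(X, Y)`: two Banach spaces which embed continuously into a common Hausdorff
topological vector space. The embeddings are the inclusions into `E`, and the Hausdorff vector
topology on `E` is only required to exist, so it may vary with the couple. (Any Hausdorff vector
topology on `X + Y` extends to one on `E`, by means of a linear complement, so it does
not matter that the topology is put on all of `E`.) -/
structure BanachCouple (𝕜 E : Type*) [RCLike 𝕜] [AddCommGroup E] [Module 𝕜 E] where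
  /-- the first space -/
  X : BanachSubspace 𝕜 E
  /-- the second space -/
  Y : BanachSubspace 𝕜 E
  exists_hausdorff_vector_topology : ∃ τ : TopologicalSpace E,
    @T2Space E τ ∧ @IsTopologicalAddGroup E τ _ ∧ @ContinuousSMul 𝕜 E _ _ τ ∧
      @Continuous X.carrier E X.normTopology τ Subtype.val ∧
      @Continuous Y.carrier E Y.normTopology τ Subtype.val

namespace BanachCouple

variable {𝕜 E : Type*} [RCLike 𝕜] [AddCommGroup E] [Module 𝕜 E]

/-- The linear space `X ∩ Y`. -/
def inter (P : BanachCouple 𝕜 E) : Submodule 𝕜 E := P.X.carrier ⊓ P.Y.carrier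

/-- The linear space `X + Y`. -/
def sum (P : BanachCouple 𝕜 E) : Submodule 𝕜 E := P.X.carrier ⊔ P.Y.carrier

theorem X_le_sum (P : BanachCouple 𝕜 E) : P.X.carrier ≤ P.sum := le_sup_left

theorem Y_le_sum (P : BanachCouple 𝕜 E) : P.Y.carrier ≤ P.sum := le_sup_right

/-- The norm `max {‖z‖_X, ‖z‖_Y}` of the intersection `X ∩ Y`. -/
noncomputable def interNorm (P : BanachCouple 𝕜 E) (z : P.inter) : ℝ :=
  max (P.X.nrm ⟨z, z.2.1⟩) (P.Y.nrm ⟨z, z.2.2⟩)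

/-- The norm `inf {‖x‖_X + ‖y‖_Y : x ∈ X, y ∈ Y, z = x + y}` of the sum `X + Y`. -/
noncomputable def sumNorm (P : BanachCouple 𝕜 E) (z : P.sum) : ℝ :=
  sInf {r : ℝ | ∃ (x : P.X.carrier) (y : P.Y.carrier),
    (z : E) = (x : E) + (y : E) ∧ r = P.X.nrm x + P.Y.nrm y}

/-- `Z` is an intermediate space: `X ∩ Y ↪ Z ↪ X + Y`, both inclusions being continuous. -/
structure IsIntermediate (P : BanachCouple 𝕜 E) (Z : BanachSubspace 𝕜 E) : Prop where
  inter_le : P.inter ≤ Z.carrier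
  inter_bound : ∃ C : ℝ, ∀ z : P.inter, Z.nrm ⟨z, inter_le z.2⟩ ≤ C * P.interNorm z
  le_sum : Z.carrier ≤ P.sum
  sum_bound : ∃ C : ℝ, ∀ z : Z.carrier, P.sumNorm ⟨z, le_sum z.2⟩ ≤ C * Z.nrm z

/-- `T` is a bounded linear operator on the couple: a linear operator in `X + Y` which maps
`X` into `X` and `Y` into `Y` boundedly. -/
def IsBoundedOperator (P : BanachCouple 𝕜 E) (T : P.sum →ₗ[𝕜] P.sum) : Prop :=
  (∃ C : ℝ, ∀ x : P.X.carrier, ∃ h : (T ⟨x, P.X_le_sum x.2⟩ : E) ∈ P.X.carrier,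
    P.X.nrm ⟨_, h⟩ ≤ C * P.X.nrm x) ∧
  (∃ C : ℝ, ∀ y : P.Y.carrier, ∃ h : (T ⟨y, P.Y_le_sum y.2⟩ : E) ∈ P.Y.carrier,
    P.Y.nrm ⟨_, h⟩ ≤ C * P.Y.nrm y)

/-- `Int(X, Y)`, the collection of all interpolation spaces: the intermediate spaces `Z` with
`T(Z) ⊆ Z` for every bounded linear operator `T` on the couple. -/
def interpolationSpaces (P : BanachCouple 𝕜 E) : Set (BanachSubspace 𝕜 E) :=
  {Z | P.IsIntermediate Z ∧ ∀ T : P.sum →ₗ[𝕜] P.sum, P.IsBoundedOperator T →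
    ∀ z : P.sum, (z : E) ∈ Z.carrier → (T z : E) ∈ Z.carrier}

/-- `(X, Y) ≃ (V, W)`: either `X ≃ V` and `Y ≃ W`, or `X ≃ W` and `Y ≃ V`. -/
def Equivalent (P Q : BanachCouple 𝕜 E) : Prop :=
  (P.X.Equivalent Q.X ∧ P.Y.Equivalent Q.Y) ∨ (P.X.Equivalent Q.Y ∧ P.Y.Equivalent Q.X)

end BanachCouple

/-! Each couple's spaces are interpolation spaces of the other, so both couples have the same
intersection D and the same sum. The comparison is made on D and then carried to the whole spaces.

On D the tool is the rank one operator f ⊗ u. It acts on the couple, and on every interpolation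
space its norm is at most C · max(‖f‖_{X*}‖u‖_X, ‖f‖_{Y*}‖u‖_Y) (`exists_uniform_bound`,
`rankOneBound`). If the norm of X is not dominated by that of Y, completeness of D gives functionals
of norm about 1 for Y and arbitrarily small for X (`dualSeparated_of_complete`). There are also
vectors whose Y-norm is tiny relative to their X-norm, and along them V or W, say V, stays bounded
below by X. These vectors make the functionals small for V too. Comparing the norms of f ⊗ u on Y
and on W then shows that Y and W are equivalent on D (`Matched.dominated`), and symmetry yields the
other pair.

Hence the closures of D agree. Beyond them, a functional vanishing on D gives a rank one operator
that is zero on the other space, so an interpolation space either contains X or lies in closure(D) +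
Y (`X_le_or_le`, `Y_le_or_le`). These alternatives and the modular law determine the pair of
subspaces (`CoupleRelations.eq_or_eq`). Equality of carriers gives equivalence of norms by the
closed graph theorem. -/

namespace Seminorm

/-! ### Comparison of the four norms on the intersection. -/

variable {𝕜 D : Type*} [RCLike 𝕜] [AddCommGroup D] [Module 𝕜 D]

theorem exists_dual_eq (p : Seminorm 𝕜 D) (x : D) :
    ∃ f : Module.Dual 𝕜 D, (∀ z, ‖f z‖ ≤ p z) ∧ ‖f x‖ = p x := by
  let : SeminormedAddCommGroup D := p.toAddGroupSeminorm.toSeminormedAddCommGroup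
  let : NormedSpace 𝕜 D := { norm_smul_le := fun a b => (map_smul_eq_mul p a b).le }
  obtain ⟨g, hg, hgx⟩ := exists_dual_vector'' 𝕜 x
  refine ⟨g.toLinearMap, fun z => ?_, ?_⟩
  · exact (g.le_of_opNorm_le hg z).trans_eq (one_mul _)
  · change ‖g x‖ = ‖x‖
    rw [hgx]; simp

/-- The seminorm `a` is bounded by a multiple of `b`. -/
def Dominated (a b : Seminorm 𝕜 D) : Prop := ∃ C : ℝ, ∀ u, a u ≤ C * b u

theorem Dominated.trans {a b c : Seminorm 𝕜 D} (h : a.Dominated b) (h' : b.Dominated c) :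
    a.Dominated c := by
  obtain ⟨C, hC⟩ := h
  obtain ⟨C', hC'⟩ := h'
  refine ⟨|C| * C', fun u => (hC u).trans ?_⟩
  calc C * b u ≤ |C| * b u := by gcongr; exact le_abs_self C
    _ ≤ |C| * (C' * c u) := by gcongr; exact hC' u
    _ = _ := by ring

theorem Dominated.exists_pos {a b : Seminorm 𝕜 D} (h : a.Dominated b) :
    ∃ C : ℝ, 0 < C ∧ ∀ u, a u ≤ C * b u := by
  obtain ⟨C, hC⟩ := h
  refine ⟨|C| + 1, by positivity, fun u => (hC u).trans ?_⟩
  gcongr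
  exact (le_abs_self C).trans (by linarith)

/-- There are functionals of norm comparable to one for `a₂` and of arbitrarily small norm
for `a₁`. -/
def DualSeparated (a₁ a₂ : Seminorm 𝕜 D) : Prop :=
  ∀ δ : ℝ, 0 < δ → ∃ (f : Module.Dual 𝕜 D) (w : D),
    (∀ z, ‖f z‖ ≤ δ * a₁ z) ∧ (∀ z, ‖f z‖ ≤ a₂ z) ∧ a₂ w < 2 * ‖f w‖

/-- Rank one operators `f ⊗ u` bounded with respect to `a₁` and `a₂` are bounded with respect
to `c`, with control of the bound. -/
def RankOneBound (a₁ a₂ c : Seminorm 𝕜 D) : Prop :=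
  ∃ C : ℝ, 0 < C ∧ ∀ (f : Module.Dual 𝕜 D) (β₁ β₂ : ℝ), 0 ≤ β₁ → 0 ≤ β₂ →
    (∀ z, ‖f z‖ ≤ β₁ * a₁ z) → (∀ z, ‖f z‖ ≤ β₂ * a₂ z) →
    ∀ u w, ‖f w‖ * c u ≤ C * max (β₁ * a₁ u) (β₂ * a₂ u) * c w

theorem RankOneBound.swap {a₁ a₂ c : Seminorm 𝕜 D} (h : RankOneBound a₁ a₂ c) :
    RankOneBound a₂ a₁ c := by
  obtain ⟨C, hC, h⟩ := h
  exact ⟨C, hC, fun f β₁ β₂ h₁ h₂ hf₁ hf₂ u w => by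
    rw [max_comm]; exact h f β₂ β₁ h₂ h₁ hf₂ hf₁ u w⟩

/-- What the norms `a₁`, `a₂` of a Banach couple and the norms `c₁`, `c₂` of two of its
interpolation spaces satisfy on the intersection of the couple. -/
structure Controls (a₁ a₂ c₁ c₂ : Seminorm 𝕜 D) : Prop where
  pos₁ : ∀ u, u ≠ 0 → 0 < a₁ u
  pos₂ : ∀ u, u ≠ 0 → 0 < a₂ u
  separated₁ : ¬ a₁.Dominated a₂ → DualSeparated a₁ a₂
  separated₂ : ¬ a₂.Dominated a₁ → DualSeparated a₂ a₁
  rankOne₁ : RankOneBound a₁ a₂ c₁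
  rankOne₂ : RankOneBound a₁ a₂ c₂
  le₁ : c₁.Dominated (a₁ ⊔ a₂)
  le₂ : c₂.Dominated (a₁ ⊔ a₂)

theorem Controls.swapLeft {a₁ a₂ c₁ c₂ : Seminorm 𝕜 D} (h : Controls a₁ a₂ c₁ c₂) :
    Controls a₂ a₁ c₁ c₂ :=
  ⟨h.pos₂, h.pos₁, h.separated₂, h.separated₁, h.rankOne₁.swap, h.rankOne₂.swap,
    sup_comm a₁ a₂ ▸ h.le₁, sup_comm a₁ a₂ ▸ h.le₂⟩

theorem Controls.swapRight {a₁ a₂ c₁ c₂ : Seminorm 𝕜 D} (h : Controls a₁ a₂ c₁ c₂) :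
    Controls a₁ a₂ c₂ c₁ :=
  ⟨h.pos₁, h.pos₂, h.separated₁, h.separated₂, h.rankOne₂, h.rankOne₁, h.le₂, h.le₁⟩

/-- Vectors on which `a₂` is small relative to `a₁`, while `c₁` is comparable to `a₁`. -/
def Matched (a₁ a₂ c₁ : Seminorm 𝕜 D) : Prop :=
  ∃ κ : ℝ, 0 < κ ∧ ∀ ε : ℝ, 0 < ε → ∃ u, u ≠ 0 ∧ a₂ u ≤ ε * a₁ u ∧ κ * a₁ u ≤ c₁ u

variable {a₁ a₂ c₁ c₂ : Seminorm 𝕜 D}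

theorem Matched.not_dominated (h : Matched a₁ a₂ c₁) (hpos : ∀ u, u ≠ 0 → 0 < a₁ u) :
    ¬ a₁.Dominated a₂ := by
  intro hd
  obtain ⟨C, hC, hd⟩ := hd.exists_pos
  obtain ⟨κ, hκ, h⟩ := h
  obtain ⟨u, hu, h1, -⟩ := h (1 / (2 * C)) (by positivity)
  have h2 := hpos u hu
  have h3 := hd u
  have : C * a₂ u ≤ C * (1 / (2 * C) * a₁ u) := by gcongr
  have h4 : C * (1 / (2 * C) * a₁ u) = a₁ u / 2 := by field_simp
  linarith

/-- If `c₁` is comparable to `a₁` on vectors with small `a₂`, then `a₂` and `c₂` are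
equivalent. -/
theorem Matched.dominated (h : Matched a₁ a₂ c₁) (hac : Controls a₁ a₂ c₁ c₂)
    (hca : Controls c₁ c₂ a₁ a₂) : a₂.Dominated c₂ ∧ c₂.Dominated a₂ := by
  have hsep := hac.separated₁ (h.not_dominated hac.pos₁)
  obtain ⟨κ, hκ, h⟩ := h
  obtain ⟨C₁, hC₁, hr₁⟩ := hac.rankOne₁
  obtain ⟨C₂, hC₂, hr₂⟩ := hac.rankOne₂
  obtain ⟨B, hB, hb⟩ := hca.rankOne₂
  obtain ⟨u₁, hu₁, -, -⟩ := h 1 one_pos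
  -- the norms of the separating functionals with respect to `c₁` and `c₂`
  have key₁ : ∀ (δ : ℝ), 0 < δ → ∀ f : Module.Dual 𝕜 D, (∀ z, ‖f z‖ ≤ δ * a₁ z) →
      (∀ z, ‖f z‖ ≤ a₂ z) → ∀ z, ‖f z‖ ≤ C₁ / κ * δ * c₁ z := by
    intro δ hδ f hf₁ hf₂ z
    -- For a matched vector the maximum in the bound for f ⊗ u is δ * a₁ u, and a₁ u cancels against
    -- c₁ u ≥ κ * a₁ u.
    obtain ⟨u, hu, hu1, hu2⟩ := h δ hδ
    have hau := hac.pos₁ u hu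
    have := hr₁ f δ 1 hδ.le zero_le_one hf₁ (by simpa using hf₂) u z
    rw [one_mul, max_eq_left hu1] at this
    have h3 : ‖f z‖ * (κ * a₁ u) ≤ C₁ * (δ * a₁ u) * c₁ z :=
      (mul_le_mul_of_nonneg_left hu2 (norm_nonneg _)).trans this
    have h4 : (‖f z‖ * κ) * a₁ u ≤ (C₁ * δ * c₁ z) * a₁ u := by linarith
    have h5 := le_of_mul_le_mul_right h4 hau
    rw [div_mul_eq_mul_div, div_mul_eq_mul_div, le_div_iff₀ hκ]
    exact h5
  have key₂ : ∃ M : ℝ, 0 < M ∧ ∀ (δ : ℝ), 0 < δ → δ ≤ 1 → ∀ f : Module.Dual 𝕜 D,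
      (∀ z, ‖f z‖ ≤ δ * a₁ z) → (∀ z, ‖f z‖ ≤ a₂ z) → ∀ z, ‖f z‖ ≤ M * c₂ z := by
    have hc := hca.pos₂ u₁ hu₁
    have ha := hac.pos₁ u₁ hu₁
    refine ⟨C₂ * max (a₁ u₁) (a₂ u₁) / c₂ u₁, by positivity, fun δ hδ hδ1 f hf₁ hf₂ z => ?_⟩
    have := hr₂ f δ 1 hδ.le zero_le_one hf₁ (by simpa using hf₂) u₁ z
    rw [div_mul_eq_mul_div, le_div_iff₀ hc]
    refine this.trans ?_
    gcongr
    · nlinarith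
    · exact (one_mul _).le
  obtain ⟨M, hM, key₂⟩ := key₂
  -- the transferred lower bound
  have low : ∀ δ : ℝ, 0 < δ → ∀ (f : Module.Dual 𝕜 D) (w : D), (∀ z, ‖f z‖ ≤ δ * a₁ z) →
      (∀ z, ‖f z‖ ≤ a₂ z) → a₂ w < 2 * ‖f w‖ → ∀ d : ℝ, 0 ≤ d → (∀ z, ‖f z‖ ≤ d * c₂ z) →
      ∀ u, a₂ u ≤ 2 * B * max (C₁ / κ * δ * c₁ u) (d * c₂ u) := by
    intro δ hδ f w hf₁ hf₂ hw d hd hfd u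
    have h1 := hb f (C₁ / κ * δ) d (by positivity) hd (key₁ δ hδ f hf₁ hf₂) hfd u w
    have h2 : 0 < a₂ w := by
      have := hf₂ w
      have := norm_nonneg (f w)
      by_contra hneg
      have : a₂ w = 0 := le_antisymm (not_lt.1 hneg) (apply_nonneg _ _)
      linarith
    have h3 : a₂ w * a₂ u ≤ 2 * ‖f w‖ * a₂ u := by gcongr
    have h4 : a₂ u * a₂ w ≤ (2 * B * max (C₁ / κ * δ * c₁ u) (d * c₂ u)) * a₂ w := by linarith
    exact le_of_mul_le_mul_right h4 h2
  constructor
  · refine ⟨2 * B * M, fun u => ?_⟩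
    by_cases hu : u = 0
    · simp [hu]
    have hc1 := hca.pos₁ u hu
    have hc2 := hca.pos₂ u hu
    -- δ depends on u: it pushes the c₁ term of `low` below the c₂ term, while δ ≤ 1 is what `key₂`
    -- needs.
    set δ := min 1 (M * c₂ u / (C₁ / κ * c₁ u)) with hδdef
    have hδ : 0 < δ := by positivity
    obtain ⟨f, w, hf₁, hf₂, hw⟩ := hsep δ hδ
    have := low δ hδ f w hf₁ hf₂ hw M hM.le (key₂ δ hδ (min_le_left _ _) f hf₁ hf₂) u
    rw [max_eq_right] at this
    · linarith
    · have h1 : δ ≤ M * c₂ u / (C₁ / κ * c₁ u) := min_le_right _ _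
      rw [le_div_iff₀ (by positivity)] at h1
      linarith
  · have ha2 := hac.pos₂ u₁ hu₁
    have ha1 := hac.pos₁ u₁ hu₁
    have hc1 := hca.pos₁ u₁ hu₁
    have hc2 := hca.pos₂ u₁ hu₁
    -- If f had c₂-dual norm at most d, `low` at u₁ would give a₂ u₁ ≤ a₂ u₁ / 2. So d is a lower
    -- bound for the c₂-dual norm of f.
    set d := a₂ u₁ / (4 * B * c₂ u₁) with hd
    have hdpos : 0 < d := by positivity
    refine ⟨C₂ / d, fun u => ?_⟩
    by_cases hu : u = 0
    · simp [hu]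
    have hau1 := hac.pos₁ u hu
    have hau2 := hac.pos₂ u hu
    -- The first entry makes a₂ u the maximum in the bound for f ⊗ u; the second makes the c₁ term
    -- of `low` at u₁ at most a₂ u₁ / (4 * B).
    set δ := min (a₂ u / a₁ u) (a₂ u₁ / (4 * B * (C₁ / κ) * c₁ u₁)) with hδdef
    have hδ : 0 < δ := by positivity
    obtain ⟨f, w, hf₁, hf₂, hw⟩ := hsep δ hδ
    have hz : ∃ z, d * c₂ z < ‖f z‖ := by
      by_contra! hcon
      have h1 := low δ hδ f w hf₁ hf₂ hw d hdpos.le hcon u₁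
      have h2 : δ ≤ a₂ u₁ / (4 * B * (C₁ / κ) * c₁ u₁) := min_le_right _ _
      rw [le_div_iff₀ (by positivity)] at h2
      have h3 : d * (4 * B * c₂ u₁) = a₂ u₁ := by rw [hd]; field_simp
      have h4 : max (C₁ / κ * δ * c₁ u₁) (d * c₂ u₁) ≤ a₂ u₁ / (4 * B) := by
        rw [le_div_iff₀ (by positivity)]
        rcases max_cases (C₁ / κ * δ * c₁ u₁) (d * c₂ u₁) with h | h <;> rw [h.1] <;> linarith
      have h5 : 2 * B * max (C₁ / κ * δ * c₁ u₁) (d * c₂ u₁) ≤ 2 * B * (a₂ u₁ / (4 * B)) := by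
        gcongr
      have h6 : 2 * B * (a₂ u₁ / (4 * B)) = a₂ u₁ / 2 := by field_simp; norm_num
      linarith
    obtain ⟨z, hz⟩ := hz
    have hz0 : z ≠ 0 := by rintro rfl; simp at hz
    have hcz := hca.pos₂ z hz0
    have h1 := hr₂ f δ 1 hδ.le zero_le_one hf₁ (by simpa using hf₂) u z
    have h2 : δ ≤ a₂ u / a₁ u := min_le_left _ _
    rw [le_div_iff₀ hau1] at h2
    rw [one_mul, max_eq_right h2] at h1
    have h3 : d * c₂ z * c₂ u ≤ ‖f z‖ * c₂ u := by gcongr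
    have h4 : (d * c₂ u) * c₂ z ≤ (C₂ * a₂ u) * c₂ z := by linarith
    have h5 := le_of_mul_le_mul_right h4 hcz
    rw [div_mul_eq_mul_div, le_div_iff₀ hdpos]
    linarith

/-- `Matched` is symmetric in the two couples. -/
theorem Matched.symm (h : Matched a₁ a₂ c₁) (hac : Controls a₁ a₂ c₁ c₂)
    (hca : Controls c₁ c₂ a₁ a₂) : Matched c₁ c₂ a₁ := by
  obtain ⟨C, hC, h2⟩ := (h.dominated hac hca).2.exists_pos
  obtain ⟨κ, hκ, h⟩ := h
  obtain ⟨M, hM, h3⟩ := hac.le₁.exists_pos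
  refine ⟨1 / M, by positivity, fun ε hε => ?_⟩
  -- The entry 1 ensures max (a₁ u) (a₂ u) = a₁ u, so that c₁ u ≤ M * a₁ u.
  obtain ⟨u, hu, h4, h5⟩ := h (min 1 (ε * κ / C)) (by positivity)
  have ha1 := hac.pos₁ u hu
  refine ⟨u, hu, ?_, ?_⟩
  · calc c₂ u ≤ C * a₂ u := h2 u
      _ ≤ C * (ε * κ / C * a₁ u) := by
        gcongr
        exact h4.trans (by gcongr; exact min_le_right _ _)
      _ = ε * (κ * a₁ u) := by field_simp
      _ ≤ ε * c₁ u := by gcongr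
  · have h6 : a₂ u ≤ a₁ u := by
      refine h4.trans ?_
      calc _ ≤ 1 * a₁ u := by gcongr; exact min_le_left _ _
        _ = _ := one_mul _
    have h7 : c₁ u ≤ M * max (a₁ u) (a₂ u) := h3 u
    rw [max_eq_left h6] at h7
    rw [div_mul_eq_mul_div, one_mul, div_le_iff₀ hM]
    linarith

/-- Since a₁ ≤ M * max c₁ c₂, at each vector c₁ or c₂ is at least a₁ / M. If both alternatives
failed with κ = 1 / M, no nonzero vector could have a₂ small relative to a₁, and a₁ would be
dominated by a₂. -/
theorem Controls.matched_or_matched (hca : Controls c₁ c₂ a₁ a₂) (h : ¬ a₁.Dominated a₂)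
    (hpos : ∀ u, u ≠ 0 → 0 < a₁ u) :
    Matched a₁ a₂ c₁ ∨ Matched a₁ a₂ c₂ := by
  obtain ⟨M, hM, hle⟩ := hca.le₁.exists_pos
  by_contra! hcon
  obtain ⟨h1, h2⟩ := hcon
  unfold Matched at h1 h2
  push Not at h1 h2
  obtain ⟨ε₁, hε₁, h1⟩ := h1 (1 / M) (by positivity)
  obtain ⟨ε₂, hε₂, h2⟩ := h2 (1 / M) (by positivity)
  refine h ⟨1 / min ε₁ ε₂, fun u => ?_⟩
  have hmin : 0 < min ε₁ ε₂ := lt_min hε₁ hε₂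
  by_cases hu : u = 0
  · simp [hu]
  rw [div_mul_eq_mul_div, one_mul, le_div_iff₀ hmin]
  by_contra! hlt
  have ha := hpos u hu
  have g1 := h1 u hu (hlt.le.trans (by rw [mul_comm]; gcongr; exact min_le_left _ _))
  have g2 := h2 u hu (hlt.le.trans (by rw [mul_comm]; gcongr; exact min_le_right _ _))
  have g3 : a₁ u ≤ M * max (c₁ u) (c₂ u) := hle u
  rw [div_mul_eq_mul_div, one_mul, lt_div_iff₀ hM] at g1 g2
  rcases max_cases (c₁ u) (c₂ u) with h | h <;> rw [h.1] at g3 <;> linarith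

theorem dominated_of_le_sup (h : c₁.Dominated (a₁ ⊔ a₂)) (h' : a₂.Dominated a₁) :
    c₁.Dominated a₁ := by
  obtain ⟨C, hC⟩ := h'
  refine h.trans ⟨max 1 C, fun u => max_le ?_ ?_⟩
  · exact (one_mul (a₁ u)).symm.trans_le (by gcongr; exact le_max_left _ _)
  · exact (hC u).trans (by gcongr; exact le_max_right _ _)

/-- `Matched.dominated` handles the second pair. For the first, if neither a₂ ≲ a₁ nor c₂ ≲ c₁
fails, then a₁ and c₁ are each equivalent to the maximum norm. If one fails, it produces a second
matching with indices exchanged, which gives the claim or a contradiction. -/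
theorem Matched.equivalent (h : Matched a₁ a₂ c₁) (hac : Controls a₁ a₂ c₁ c₂)
    (hca : Controls c₁ c₂ a₁ a₂) :
    (a₁.Dominated c₁ ∧ c₁.Dominated a₁) ∧ (a₂.Dominated c₂ ∧ c₂.Dominated a₂) := by
  have h2 := h.dominated hac hca
  have hnd := h.not_dominated hac.pos₁
  have hnd' := (h.symm hac hca).not_dominated hca.pos₁
  refine ⟨?_, h2⟩
  by_cases hd : a₂.Dominated a₁
  · by_cases hd' : c₂.Dominated c₁
    · exact ⟨dominated_of_le_sup hca.le₁ hd', dominated_of_le_sup hac.le₁ hd⟩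
    · exfalso
      rcases (hac.swapRight.matched_or_matched hd' hca.pos₂).symm with h3 | h3
      · exact (h3.symm hca.swapLeft.swapRight hac.swapLeft.swapRight).not_dominated hac.pos₂ hd
      · have h4 := h3.symm hca.swapLeft hac.swapRight
        have h5 := h4.dominated hac.swapRight hca.swapLeft
        exact hnd' (h5.2.trans h2.1)
  · rcases hca.swapRight.matched_or_matched hd hac.pos₂ with h3 | h3
    · exact absurd (h3.dominated hac.swapLeft hca.swapRight).1
        fun h4 => hnd (h4.trans h2.2)
    · exact h3.dominated hac.swapLeft.swapRight hca.swapLeft.swapRight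

/-- Any failure of domination within a couple produces a matching. If a₁ and a₂ are equivalent, so
are c₁ and c₂, since a matching would pass back by `Matched.symm`; all four norms are then
equivalent. -/
theorem Controls.equivalent_or_equivalent (hac : Controls a₁ a₂ c₁ c₂)
    (hca : Controls c₁ c₂ a₁ a₂) :
    ((a₁.Dominated c₁ ∧ c₁.Dominated a₁) ∧ (a₂.Dominated c₂ ∧ c₂.Dominated a₂)) ∨
    ((a₁.Dominated c₂ ∧ c₂.Dominated a₁) ∧ (a₂.Dominated c₁ ∧ c₁.Dominated a₂)) := by
  by_cases h12 : a₁.Dominated a₂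
  · by_cases h21 : a₂.Dominated a₁
    · by_cases g12 : c₁.Dominated c₂
      · by_cases g21 : c₂.Dominated c₁
        · left
          refine ⟨⟨dominated_of_le_sup hca.le₁ g21, dominated_of_le_sup hac.le₁ h21⟩,
            dominated_of_le_sup hca.swapLeft.le₂ g12, dominated_of_le_sup hac.swapLeft.le₂ h12⟩
        · rcases (hac.swapRight.matched_or_matched g21 hca.pos₂).symm with h3 | h3
          · exact absurd h21 ((h3.symm hca.swapLeft.swapRight
              hac.swapLeft.swapRight).not_dominated hac.pos₂)
          · exact absurd h12 ((h3.symm hca.swapLeft hac.swapRight).not_dominated hac.pos₁)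
      · rcases hac.matched_or_matched g12 hca.pos₁ with h3 | h3
        · exact absurd h12 ((h3.symm hca hac).not_dominated hac.pos₁)
        · exact absurd h21 ((h3.symm hca.swapRight hac.swapLeft).not_dominated hac.pos₂)
    · rcases hca.swapRight.matched_or_matched h21 hac.pos₂ with h3 | h3
      · right
        exact (h3.equivalent hac.swapLeft hca.swapRight).symm
      · left
        exact (h3.equivalent hac.swapLeft.swapRight hca.swapLeft.swapRight).symm
  · rcases hca.matched_or_matched h12 hac.pos₁ with h3 | h3
    · exact .inl (h3.equivalent hac hca)
    · exact .inr (h3.equivalent hac.swapRight hca.swapLeft)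

end Seminorm

open Filter Topology

/-! ### Separation of dual norms from completeness. -/

namespace Seminorm

variable {𝕜 D : Type*} [RCLike 𝕜] [AddCommGroup D] [Module 𝕜 D]

/-- If `D` is complete in the norm `max a₁ a₂` and `a₁` is not dominated by `a₂`, the dual norms
are separated. -/
theorem dualSeparated_of_complete {a₁ a₂ : Seminorm 𝕜 D} (hpos : ∀ u, u ≠ 0 → 0 < a₂ u)
    (hcomplete : ∀ x : ℕ → D, Summable (fun n => a₁ (x n)) → Summable (fun n => a₂ (x n)) →
      ∃ s, Tendsto (fun n => a₁ (s - ∑ k ∈ Finset.range n, x k)) atTop (𝓝 0) ∧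
        Tendsto (fun n => a₂ (s - ∑ k ∈ Finset.range n, x k)) atTop (𝓝 0))
    (h : ¬ a₁.Dominated a₂) : DualSeparated a₁ a₂ := by
  intro δ hδ
  by_contra! hcon
  let r : NNReal := ⟨δ, hδ.le⟩
  have split : ∀ w, ∃ x, δ * a₁ x + a₂ (w - x) ≤ 3 / 4 * a₂ w := by
    intro w
    by_cases hw : w = 0
    · exact ⟨0, by simp [hw]⟩
    -- The infimum of seminorms is the infimal convolution. A norming functional for it is bounded
    -- by both seminorms, so `hcon` forces its value at w down to a₂ w / 2. The factor 3 / 4 leaves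
    -- room for an unattained infimum.
    obtain ⟨f, hf, hfw⟩ := exists_dual_eq (r • a₁ ⊓ a₂) w
    have h1 := hcon f w (fun z => (hf z).trans (inf_le_left (a := r • a₁) z))
      (fun z => (hf z).trans (inf_le_right (a := r • a₁) z))
    rw [hfw, inf_apply] at h1
    have h2 := hpos w hw
    obtain ⟨x, hx⟩ := exists_lt_of_ciInf_lt
      (show (⨅ u : D, (r • a₁) u + a₂ (w - u)) < 3 / 4 * a₂ w by linarith)
    exact ⟨x, hx.le⟩
  choose g hg using split
  -- Splitting is iterated on the remainders y n. The pieces have a₁ at most (3 / 4) ^ n * a₂ u / δ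
  -- and sum to u, whence the constant 4 / δ.
  refine h ⟨4 / δ, fun u => ?_⟩
  let y : ℕ → D := fun n => n.rec u (fun _ v => v - g v)
  have hy0 : y 0 = u := rfl
  have hys : ∀ n, y (n + 1) = y n - g (y n) := fun n => rfl
  have hy : ∀ n, a₂ (y n) ≤ (3 / 4) ^ n * a₂ u := by
    intro n
    induction n with
    | zero => simp [hy0]
    | succ n ih =>
      have h1 := hg (y n)
      rw [← hys] at h1
      have h2 : 0 ≤ δ * a₁ (g (y n)) := by positivity
      rw [pow_succ]
      linarith
  have hg1 : ∀ n, a₁ (g (y n)) ≤ 1 / δ * a₂ u * (3 / 4) ^ n := by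
    intro n
    have h1 := hg (y n)
    have h2 : 0 ≤ a₂ (y n - g (y n)) := by positivity
    have h3 := hy n
    have h4 : 0 ≤ a₂ (y n) := by positivity
    rw [mul_assoc, div_mul_eq_mul_div, le_div_iff₀ hδ]
    linarith
  have hg2 : ∀ n, a₂ (g (y n)) ≤ 2 * a₂ u * (3 / 4) ^ n := by
    intro n
    have h1 := hg (y n)
    have h2 : 0 ≤ δ * a₁ (g (y n)) := by positivity
    have h3 := hy n
    have h4 : a₂ (g (y n)) ≤ a₂ (y n) + a₂ (y n - g (y n)) := by
      have := map_sub_le_add a₂ (y n) (y n - g (y n))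
      simpa using this
    have h5 : 0 ≤ a₂ (y n) := by positivity
    linarith
  have hgeom : Summable fun n : ℕ => (3 / 4 : ℝ) ^ n :=
    summable_geometric_of_lt_one (by norm_num) (by norm_num)
  have hs1 : Summable fun n => a₁ (g (y n)) :=
    .of_nonneg_of_le (fun n => apply_nonneg _ _) hg1 (hgeom.mul_left _)
  obtain ⟨s, hs, hs'⟩ := hcomplete (fun n => g (y n)) hs1
    (.of_nonneg_of_le (fun n => apply_nonneg _ _) hg2 (hgeom.mul_left _))
  have hsum : ∀ n, ∑ k ∈ Finset.range n, g (y k) = u - y n := by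
    intro n
    induction n with
    | zero => simp [hy0]
    | succ n ih => rw [Finset.sum_range_succ, ih, hys]; abel
  have hylim : Tendsto (fun n => a₂ (y n)) atTop (𝓝 0) := by
    have := (tendsto_pow_atTop_nhds_zero_of_lt_one (r := (3 / 4 : ℝ)) (by norm_num)
      (by norm_num)).mul_const (a₂ u)
    rw [zero_mul] at this
    exact squeeze_zero (fun n => apply_nonneg _ _) hy this
  have hsu : s = u := by
    by_contra hne
    have h1 := hpos (s - u) (sub_ne_zero.2 hne)
    have h2 : a₂ (s - u) ≤ 0 := by
      have := hs'.add hylim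
      rw [add_zero] at this
      refine ge_of_tendsto' this fun n => ?_
      have h3 := map_sub_le_add a₂ (s - ∑ k ∈ Finset.range n, g (y k)) (y n)
      rw [hsum] at h3 ⊢
      rwa [show s - (u - y n) - y n = s - u by abel] at h3
    linarith
  subst hsu
  have h1 : a₁ s ≤ 0 + 1 / δ * a₂ s * (1 - 3 / 4)⁻¹ := by
    have h2 := hs.add_const (1 / δ * a₂ s * (1 - 3 / 4)⁻¹)
    refine ge_of_tendsto' h2 fun n => ?_
    have h3 : a₁ s ≤ a₁ (s - ∑ k ∈ Finset.range n, g (y k)) + a₁ (∑ k ∈ Finset.range n, g (y k)) := by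
      have := map_add_le_add a₁ (s - ∑ k ∈ Finset.range n, g (y k))
        (∑ k ∈ Finset.range n, g (y k))
      simpa using this
    refine h3.trans ?_
    gcongr
    calc a₁ (∑ k ∈ Finset.range n, g (y k)) ≤ ∑ k ∈ Finset.range n, a₁ (g (y k)) :=
          Finset.le_sum_of_subadditive a₁ (map_zero a₁).le (map_add_le_add a₁) _ _
      _ ≤ ∑ k ∈ Finset.range n, 1 / δ * a₂ s * (3 / 4) ^ k := by gcongr; exact hg1 _
      _ = 1 / δ * a₂ s * ∑ k ∈ Finset.range n, (3 / 4) ^ k := by rw [Finset.mul_sum]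
      _ ≤ 1 / δ * a₂ s * (1 - 3 / 4)⁻¹ := by
        gcongr
        rw [← tsum_geometric_of_lt_one (by norm_num) (by norm_num)]
        exact hgeom.sum_le_tsum _ fun _ _ => by positivity
  refine h1.trans_eq ?_
  ring

end Seminorm

/-! ### Closed graph arguments for Banach subspaces. -/

namespace BanachSubspace

variable {𝕜 E : Type*} [RCLike 𝕜] [AddCommGroup E] [Module 𝕜 E]

/-- The underlying linear space of `Z`, as a normed space. -/
def Space (Z : BanachSubspace 𝕜 E) : Type _ := Z.carrier

noncomputable instance (Z : BanachSubspace 𝕜 E) : NormedAddCommGroup Z.Space :=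
  letI := Z.nrm.toAddGroupSeminorm.toSeminormedAddCommGroup
  NormedAddCommGroup.ofSeparation (E := Z.carrier) Z.eq_zero_of_nrm_eq_zero

instance (Z : BanachSubspace 𝕜 E) : Module 𝕜 Z.Space :=
  (inferInstance : Module 𝕜 Z.carrier)

noncomputable instance (Z : BanachSubspace 𝕜 E) : NormedSpace 𝕜 Z.Space where
  norm_smul_le a b := (map_smul_eq_mul Z.nrm a b).le

instance (Z : BanachSubspace 𝕜 E) : CompleteSpace Z.Space := Z.complete

/-- The inclusion of `Z` into `E`. -/
def incl (Z : BanachSubspace 𝕜 E) : Z.Space →ₗ[𝕜] E := Z.carrier.subtype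

theorem incl_injective (Z : BanachSubspace 𝕜 E) : Function.Injective Z.incl :=
  Subtype.val_injective

theorem incl_mem (Z : BanachSubspace 𝕜 E) (z : Z.Space) : Z.incl z ∈ Z.carrier := z.2

theorem nrm_eq_norm (Z : BanachSubspace 𝕜 E) {x : E} (hx : x ∈ Z.carrier) (z : Z.Space)
    (h : x = Z.incl z) : Z.nrm ⟨x, hx⟩ = ‖z‖ := by
  subst h; rfl

/-- The norm of `Z` on a subspace. -/
def restrict (Z : BanachSubspace 𝕜 E) {D : Submodule 𝕜 E} (h : D ≤ Z.carrier) : Seminorm 𝕜 D :=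
  Z.nrm.comp (Submodule.inclusion h)

theorem restrict_apply (Z : BanachSubspace 𝕜 E) {D : Submodule 𝕜 E} (h : D ≤ Z.carrier) (d : D) :
    Z.restrict h d = Z.nrm ⟨d, h d.2⟩ := rfl

theorem restrict_pos (Z : BanachSubspace 𝕜 E) {D : Submodule 𝕜 E} (h : D ≤ Z.carrier) (u : D)
    (hu : u ≠ 0) : 0 < Z.restrict h u := by
  refine lt_of_le_of_ne (apply_nonneg _ _) fun h0 => hu ?_
  have := Z.eq_zero_of_nrm_eq_zero ⟨u, h u.2⟩ h0.symm
  have : (u : E) = 0 := congrArg Subtype.val this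
  exact Subtype.ext this

variable [TopologicalSpace E] [T2Space E]

/-- A closed graph theorem for linear maps into `Z`. -/
theorem continuous_of_continuous_incl_comp {F : Type*} [NormedAddCommGroup F] [NormedSpace 𝕜 F]
    [CompleteSpace F] (Z : BanachSubspace 𝕜 E) (hZ : Continuous Z.incl) (T : F →ₗ[𝕜] Z.Space)
    (hT : Continuous fun x => Z.incl (T x)) : Continuous T := by
  refine T.continuous_of_seq_closed_graph fun u x y hu hy => Z.incl_injective ?_
  exact tendsto_nhds_unique ((hZ.tendsto y).comp hy) ((hT.tendsto x).comp hu)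

/-- A larger space has a weaker norm. -/
theorem exists_nrm_le_of_le {Z Z' : BanachSubspace 𝕜 E} (hZ : Continuous Z.incl)
    (hZ' : Continuous Z'.incl) (h : Z.carrier ≤ Z'.carrier) :
    ∃ C : ℝ, ∀ (x : E) (hx : x ∈ Z.carrier), Z'.nrm ⟨x, h hx⟩ ≤ C * Z.nrm ⟨x, hx⟩ := by
  let T : Z.Space →ₗ[𝕜] Z'.Space := Submodule.inclusion h
  have hT : Continuous T := Z'.continuous_of_continuous_incl_comp hZ' T hZ
  let T' : Z.Space →L[𝕜] Z'.Space := ⟨T, hT⟩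
  exact ⟨‖T'‖, fun x hx => T'.le_opNorm (⟨x, hx⟩ : Z.carrier)⟩

theorem equivalent_of_carrier_eq {Z Z' : BanachSubspace 𝕜 E} (hZ : Continuous Z.incl)
    (hZ' : Continuous Z'.incl) (h : Z.carrier = Z'.carrier) : Z.Equivalent Z' := by
  obtain ⟨C, hC⟩ := exists_nrm_le_of_le hZ hZ' h.le
  obtain ⟨C', hC'⟩ := exists_nrm_le_of_le hZ' hZ h.ge
  refine ⟨h, max C C', fun x hx hx' => ⟨(hC' x hx').trans ?_, (hC x hx).trans ?_⟩⟩
  · gcongr; exact le_max_right _ _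
  · gcongr; exact le_max_left _ _

/-- Since `X ∩ Y` is complete, the norms of `X` and `Y` on it are dually separated. -/
theorem dualSeparated_restrict {X Y : BanachSubspace 𝕜 E} (hX : Continuous X.incl)
    (hY : Continuous Y.incl) {D : Submodule 𝕜 E} (hDX : D ≤ X.carrier) (hDY : D ≤ Y.carrier)
    (hD : X.carrier ⊓ Y.carrier ≤ D) (h : ¬ (X.restrict hDX).Dominated (Y.restrict hDY)) :
    (X.restrict hDX).DualSeparated (Y.restrict hDY) := by
  refine Seminorm.dualSeparated_of_complete (Y.restrict_pos hDY) (fun x h1 h2 => ?_) h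
  let iX : D →ₗ[𝕜] X.Space := Submodule.inclusion hDX
  let iY : D →ₗ[𝕜] Y.Space := Submodule.inclusion hDY
  have h1' : Summable fun n => iX (x n) := Summable.of_norm h1
  have h2' : Summable fun n => iY (x n) := Summable.of_norm h2
  have t1 := h1'.hasSum.tendsto_sum_nat
  have t2 := h2'.hasSum.tendsto_sum_nat
  set s := ∑' n, iX (x n)
  set s' := ∑' n, iY (x n)
  have hss : X.incl s = Y.incl s' := by
    refine tendsto_nhds_unique ((hX.tendsto s).comp t1) (((hY.tendsto s').comp t2).congr fun n => ?_)
    simp only [Function.comp, map_sum]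
    rfl
  have hs : X.incl s ∈ D := hD ⟨X.incl_mem s, hss ▸ Y.incl_mem s'⟩
  have e1 : iX ⟨X.incl s, hs⟩ = s := rfl
  have e2 : iY ⟨X.incl s, hs⟩ = s' := Y.incl_injective hss
  refine ⟨⟨X.incl s, hs⟩, ?_, ?_⟩
  · have := (tendsto_iff_norm_sub_tendsto_zero.1 t1)
    refine this.congr fun n => ?_
    rw [norm_sub_rev]
    nth_rewrite 1 [← e1]
    rw [← map_sum, ← map_sub]; rfl
  · have := (tendsto_iff_norm_sub_tendsto_zero.1 t2)
    refine this.congr fun n => ?_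
    rw [norm_sub_rev]
    nth_rewrite 1 [← e2]
    rw [← map_sum, ← map_sub]; rfl

end BanachSubspace

/-! ### Operators on a couple and uniform boundedness. -/

namespace BanachCouple

variable {𝕜 E : Type*} [RCLike 𝕜] [AddCommGroup E] [Module 𝕜 E]

/-- Linear maps on `X` and `Y` which agree on `X ∩ Y` have a common extension to `X + Y`. -/
theorem exists_glue (P : BanachCouple 𝕜 E) {G : Type*} [AddCommGroup G] [Module 𝕜 G]
    (A : P.X.Space →ₗ[𝕜] G) (B : P.Y.Space →ₗ[𝕜] G)
    (h : ∀ x y, P.X.incl x = P.Y.incl y → A x = B y) :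
    ∃ T : P.sum →ₗ[𝕜] G, (∀ x, T ⟨P.X.incl x, P.X_le_sum x.2⟩ = A x) ∧
      ∀ y, T ⟨P.Y.incl y, P.Y_le_sum y.2⟩ = B y := by
  let f : E →ₗ.[𝕜] G := ⟨P.X.carrier, A⟩
  let g : E →ₗ.[𝕜] G := ⟨P.Y.carrier, B⟩
  refine ⟨(f.sup g h).toFun, fun x => ?_, fun y => ?_⟩
  · exact ((f.left_le_sup g h).2 (x := (x : P.X.carrier)) rfl).symm
  · exact ((f.right_le_sup g h).2 (x := (y : P.Y.carrier)) rfl).symm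

theorem exists_add_eq (P : BanachCouple 𝕜 E) {z : E} (hz : z ∈ P.sum) :
    ∃ (x : P.X.Space) (y : P.Y.Space), P.X.incl x + P.Y.incl y = z := by
  obtain ⟨x, hx, y, hy, h⟩ := Submodule.mem_sup.1 hz
  exact ⟨(⟨x, hx⟩ : P.X.carrier), (⟨y, hy⟩ : P.Y.carrier), h⟩

theorem sumNorm_le (P : BanachCouple 𝕜 E) (x : P.X.carrier) (y : P.Y.carrier) (z : P.sum)
    (h : (z : E) = x + y) : P.sumNorm z ≤ P.X.nrm x + P.Y.nrm y := by
  refine csInf_le ⟨0, ?_⟩ ⟨x, y, h, rfl⟩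
  rintro r ⟨x, y, -, rfl⟩
  positivity

theorem exists_lt_of_sumNorm_lt (P : BanachCouple 𝕜 E) (z : P.sum) {r : ℝ}
    (h : P.sumNorm z < r) : ∃ (x : P.X.Space) (y : P.Y.Space),
      P.X.incl x + P.Y.incl y = z ∧ ‖x‖ + ‖y‖ < r := by
  obtain ⟨x, y, hxy⟩ := P.exists_add_eq z.2
  have hne : {r : ℝ | ∃ (x : P.X.carrier) (y : P.Y.carrier),
      (z : E) = (x : E) + (y : E) ∧ r = P.X.nrm x + P.Y.nrm y}.Nonempty :=
    ⟨‖x‖ + ‖y‖, x, y, hxy.symm, rfl⟩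
  obtain ⟨s, ⟨x, y, h, rfl⟩, hs⟩ := exists_lt_of_csInf_lt hne h
  exact ⟨x, y, h.symm, hs⟩

theorem X_mem (P : BanachCouple 𝕜 E) : P.X ∈ P.interpolationSpaces := by
  refine ⟨⟨inf_le_left, ⟨1, fun z => ?_⟩, P.X_le_sum, ⟨1, fun z => ?_⟩⟩, fun T hT z hz => ?_⟩
  · rw [one_mul]; exact le_max_left _ _
  · simpa using P.sumNorm_le z 0 ⟨z, P.X_le_sum z.2⟩ (by simp)
  · obtain ⟨C, hC⟩ := hT.1
    exact (hC ⟨z, hz⟩).1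

theorem Y_mem (P : BanachCouple 𝕜 E) : P.Y ∈ P.interpolationSpaces := by
  refine ⟨⟨inf_le_right, ⟨1, fun z => ?_⟩, P.Y_le_sum, ⟨1, fun z => ?_⟩⟩, fun T hT z hz => ?_⟩
  · rw [one_mul]; exact le_max_right _ _
  · simpa using P.sumNorm_le 0 z ⟨z, P.Y_le_sum z.2⟩ (by simp)
  · obtain ⟨C, hC⟩ := hT.2
    exact (hC ⟨z, hz⟩).1

variable (P : BanachCouple 𝕜 E) {Z : BanachSubspace 𝕜 E}

/-- The Banach space of pairs of bounded operators on `X` and `Y` which agree on `X ∩ Y`. -/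
def operators : Submodule 𝕜 ((P.X.Space →L[𝕜] P.X.Space) × (P.Y.Space →L[𝕜] P.Y.Space)) where
  carrier := {A | ∀ x y, P.X.incl x = P.Y.incl y → P.X.incl (A.1 x) = P.Y.incl (A.2 y)}
  zero_mem' x y _ := by simp
  add_mem' h h' x y e := by simp [h x y e, h' x y e]
  smul_mem' c A h x y e := by simp [h x y e]

theorem exists_operator (A : P.operators) : ∃ T : P.sum →ₗ[𝕜] P.sum, P.IsBoundedOperator T ∧
    (∀ x, (T ⟨P.X.incl x, P.X_le_sum x.2⟩ : E) = P.X.incl (A.1.1 x)) ∧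
    (∀ y, (T ⟨P.Y.incl y, P.Y_le_sum y.2⟩ : E) = P.Y.incl (A.1.2 y)) := by
  let iX : P.X.Space →ₗ[𝕜] P.sum := Submodule.inclusion P.X_le_sum
  let iY : P.Y.Space →ₗ[𝕜] P.sum := Submodule.inclusion P.Y_le_sum
  obtain ⟨T, h1, h2⟩ := P.exists_glue (iX ∘ₗ A.1.1.toLinearMap) (iY ∘ₗ A.1.2.toLinearMap)
    fun x y e => Subtype.ext (A.2 x y e)
  have h1' : ∀ x, (T ⟨P.X.incl x, P.X_le_sum x.2⟩ : E) = P.X.incl (A.1.1 x) :=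
    fun x => congrArg Subtype.val (h1 x)
  have h2' : ∀ x, (T ⟨P.Y.incl x, P.Y_le_sum x.2⟩ : E) = P.Y.incl (A.1.2 x) :=
    fun x => congrArg Subtype.val (h2 x)
  refine ⟨T, ⟨⟨‖A.1.1‖, fun x => ?_⟩, ⟨‖A.1.2‖, fun x => ?_⟩⟩, h1', h2'⟩
  · have e : (T ⟨x, P.X_le_sum x.2⟩ : E) = P.X.incl (A.1.1 x) := h1' x
    refine ⟨e ▸ P.X.incl_mem _, ?_⟩
    have := A.1.1.le_opNorm x
    rwa [P.X.nrm_eq_norm _ _ e]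
  · have e : (T ⟨x, P.Y_le_sum x.2⟩ : E) = P.Y.incl (A.1.2 x) := h2' x
    refine ⟨e ▸ P.Y.incl_mem _, ?_⟩
    have := A.1.2.le_opNorm x
    rwa [P.Y.nrm_eq_norm _ _ e]

theorem mem_of_operator (hZ : Z ∈ P.interpolationSpaces) (A : P.operators) (x : P.X.Space)
    (y : P.Y.Space) (h : P.X.incl x + P.Y.incl y ∈ Z.carrier) :
    P.X.incl (A.1.1 x) + P.Y.incl (A.1.2 y) ∈ Z.carrier := by
  obtain ⟨T, hT, h1, h2⟩ := P.exists_operator A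
  have := hZ.2 T hT (⟨P.X.incl x, P.X_le_sum x.2⟩ + ⟨P.Y.incl y, P.Y_le_sum y.2⟩) h
  rwa [map_add, Submodule.coe_add, h1, h2] at this

/-- A linear map on `X + Y` which is continuous on `X` and on `Y` is continuous on every
intermediate space. -/
theorem continuous_of_isIntermediate [TopologicalSpace E] [IsTopologicalAddGroup E]
    (hZ : P.IsIntermediate Z) (T : P.sum →ₗ[𝕜] E)
    (hX : Continuous fun x : P.X.Space => T ⟨P.X.incl x, P.X_le_sum x.2⟩)
    (hY : Continuous fun y : P.Y.Space => T ⟨P.Y.incl y, P.Y_le_sum y.2⟩) :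
    Continuous fun z : Z.Space => T ⟨Z.incl z, hZ.le_sum z.2⟩ := by
  let S : Z.Space →ₗ[𝕜] E := T ∘ₗ Submodule.inclusion hZ.le_sum
  change Continuous S
  refine continuous_of_continuousAt_zero S ?_
  rw [ContinuousAt, map_zero]
  intro U hU
  obtain ⟨V, hV, hVU⟩ : ∃ V ∈ 𝓝 (0 : E), ∀ v ∈ V, ∀ w ∈ V, v + w ∈ U :=
    exists_nhds_zero_half hU
  have tX : ∀ᶠ x in 𝓝 (0 : P.X.Space), T ⟨P.X.incl x, P.X_le_sum x.2⟩ ∈ V := by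
    refine hX.tendsto 0 ?_
    convert hV
    exact map_zero T
  have tY : ∀ᶠ x in 𝓝 (0 : P.Y.Space), T ⟨P.Y.incl x, P.Y_le_sum x.2⟩ ∈ V := by
    refine hY.tendsto 0 ?_
    convert hV
    exact map_zero T
  obtain ⟨δ₁, h₁, tX⟩ := Metric.eventually_nhds_iff.1 tX
  obtain ⟨δ₂, h₂, tY⟩ := Metric.eventually_nhds_iff.1 tY
  obtain ⟨C, hC⟩ := hZ.sum_bound
  refine Metric.eventually_nhds_iff.2 ⟨min δ₁ δ₂ / (|C| + 1), by positivity, fun z hz => ?_⟩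
  rw [dist_zero_right, lt_div_iff₀ (by positivity)] at hz
  have h3 : P.sumNorm ⟨Z.incl z, hZ.le_sum z.2⟩ < min δ₁ δ₂ := by
    refine (hC z).trans_lt (lt_of_le_of_lt ?_ hz)
    rw [mul_comm]
    change ‖z‖ * C ≤ _
    gcongr
    exact (le_abs_self C).trans (by linarith)
  obtain ⟨x, y, hxy, hlt⟩ := P.exists_lt_of_sumNorm_lt _ h3
  have hx : T ⟨P.X.incl x, P.X_le_sum x.2⟩ ∈ V := tX <| by
    rw [dist_zero_right]
    exact lt_of_lt_of_le (show ‖x‖ < min δ₁ δ₂ by linarith [norm_nonneg y]) (min_le_left _ _)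
  have hy : T ⟨P.Y.incl y, P.Y_le_sum y.2⟩ ∈ V := tY <| by
    rw [dist_zero_right]
    exact lt_of_lt_of_le (show ‖y‖ < min δ₁ δ₂ by linarith [norm_nonneg x]) (min_le_right _ _)
  have := hVU _ hx _ hy
  have e : (⟨Z.incl z, hZ.le_sum z.2⟩ : P.sum) =
    ⟨P.X.incl x, P.X_le_sum x.2⟩ + ⟨P.Y.incl y, P.Y_le_sum y.2⟩ := Subtype.ext hxy.symm
  rw [← map_add, ← e] at this
  exact this

theorem continuous_incl [TopologicalSpace E] [IsTopologicalAddGroup E]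
    (hX : Continuous P.X.incl) (hY : Continuous P.Y.incl)
    (hZ : P.IsIntermediate Z) : Continuous Z.incl :=
  P.continuous_of_isIntermediate hZ P.sum.subtype hX hY

theorem isClosed_operators [TopologicalSpace E] [T2Space E]
    (hX : Continuous P.X.incl) (hY : Continuous P.Y.incl) :
    IsClosed (P.operators : Set ((P.X.Space →L[𝕜] P.X.Space) × (P.Y.Space →L[𝕜] P.Y.Space))) := by
  have : (P.operators : Set ((P.X.Space →L[𝕜] P.X.Space) × (P.Y.Space →L[𝕜] P.Y.Space))) =
      ⋂ (x : P.X.Space) (y : P.Y.Space) (_ : P.X.incl x = P.Y.incl y),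
        {A | P.X.incl (A.1 x) = P.Y.incl (A.2 y)} := by
    ext A; simp [operators]
  rw [this]
  refine isClosed_iInter fun x => isClosed_iInter fun y => isClosed_iInter fun _ => ?_
  exact isClosed_eq (hX.comp (by fun_prop)) (hY.comp (by fun_prop))

/-- Operators on a couple act on interpolation spaces with uniform bounds. -/
theorem exists_uniform_bound [TopologicalSpace E] [T2Space E] [IsTopologicalAddGroup E]
    (hX : Continuous P.X.incl) (hY : Continuous P.Y.incl)
    (hZ : Z ∈ P.interpolationSpaces) :
    ∃ C : ℝ, 0 < C ∧ ∀ (A : P.operators) (x : P.X.Space) (y : P.Y.Space)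
      (h : P.X.incl x + P.Y.incl y ∈ Z.carrier),
      Z.nrm ⟨_, P.mem_of_operator hZ A x y h⟩ ≤ C * ‖A‖ * Z.nrm ⟨_, h⟩ := by
  have hZi := P.continuous_incl hX hY hZ.1
  have : CompleteSpace P.operators := (P.isClosed_operators hX hY).completeSpace_coe
  -- The decomposition is arbitrary; `key` shows that the action of A on z does not depend on it.
  choose x y hxy using fun z : Z.Space => P.exists_add_eq (hZ.1.le_sum z.2)
  have hmem : ∀ z, P.X.incl (x z) + P.Y.incl (y z) ∈ Z.carrier := fun z => hxy z ▸ z.2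
  -- the orbit map of `z`
  let orb₀ : ∀ z : Z.Space, P.operators →ₗ[𝕜] Z.Space := fun z =>
    { toFun := fun A => (⟨_, P.mem_of_operator hZ A _ _ (hmem z)⟩ : Z.carrier)
      map_add' := fun A B => Z.incl_injective (by
        change P.X.incl (A.1.1 (x z) + B.1.1 (x z)) + P.Y.incl (A.1.2 (y z) + B.1.2 (y z)) =
          (P.X.incl (A.1.1 (x z)) + P.Y.incl (A.1.2 (y z))) +
          (P.X.incl (B.1.1 (x z)) + P.Y.incl (B.1.2 (y z)))
        rw [map_add, map_add]; abel)
      map_smul' := fun c A => Z.incl_injective (by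
        change P.X.incl (c • A.1.1 (x z)) + P.Y.incl (c • A.1.2 (y z)) =
          c • (P.X.incl (A.1.1 (x z)) + P.Y.incl (A.1.2 (y z)))
        rw [map_smul, map_smul, smul_add]) }
  have horb₀ : ∀ z A, Z.incl (orb₀ z A) = P.X.incl (A.1.1 (x z)) + P.Y.incl (A.1.2 (y z)) :=
    fun z A => rfl
  let orb : ∀ z : Z.Space, P.operators →L[𝕜] Z.Space := fun z => ⟨orb₀ z, by
    refine Z.continuous_of_continuous_incl_comp (F := P.operators) hZi (orb₀ z) ?_
    simp only [horb₀]
    exact (hX.comp (by fun_prop)).add (hY.comp (by fun_prop))⟩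
  have horb : ∀ z A, Z.incl (orb z A) = P.X.incl (A.1.1 (x z)) + P.Y.incl (A.1.2 (y z)) :=
    fun z A => rfl
  -- the operators extend to `X + Y`
  have key : ∀ A : P.operators, ∃ S : Z.Space →L[𝕜] Z.Space, (∀ z, S z = orb z A) ∧
      ∀ x y (h : P.X.incl x + P.Y.incl y ∈ Z.carrier),
        Z.incl (S (⟨_, h⟩ : Z.carrier)) = P.X.incl (A.1.1 x) + P.Y.incl (A.1.2 y) := by
    intro A
    obtain ⟨T, hT, h1, h2⟩ := P.exists_operator A
    let S₀ : Z.Space →ₗ[𝕜] Z.Space := LinearMap.codRestrict Z.carrier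
      (P.sum.subtype ∘ₗ T ∘ₗ Submodule.inclusion hZ.1.le_sum)
      fun z => hZ.2 T hT ⟨Z.incl z, hZ.1.le_sum z.2⟩ z.2
    have hS : ∀ x y (h : P.X.incl x + P.Y.incl y ∈ Z.carrier),
        Z.incl (S₀ (⟨_, h⟩ : Z.carrier)) = P.X.incl (A.1.1 x) + P.Y.incl (A.1.2 y) := by
      intro x y h
      have : Z.incl (S₀ (⟨_, h⟩ : Z.carrier)) =
        (T (⟨P.X.incl x, P.X_le_sum x.2⟩ + ⟨P.Y.incl y, P.Y_le_sum y.2⟩) : E) := rfl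
      rw [this, map_add, Submodule.coe_add, h1, h2]
    have hS₀ : Continuous S₀ := by
      refine Z.continuous_of_continuous_incl_comp hZi S₀ ?_
      refine P.continuous_of_isIntermediate hZ.1 (P.sum.subtype ∘ₗ T) ?_ ?_
      · exact (hX.comp A.1.1.continuous).congr fun x => (h1 x).symm
      · exact (hY.comp A.1.2.continuous).congr fun x => (h2 x).symm
    refine ⟨⟨S₀, hS₀⟩, fun z => Z.incl_injective ?_, hS⟩
    rw [horb, ← hS _ _ (hmem z)]
    have : z = (⟨_, hmem z⟩ : Z.carrier) := Subtype.ext (hxy z).symm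
    exact congrArg (fun z => Z.incl (S₀ z)) this
  -- Banach–Steinhaus is applied to orbit maps, indexed by z. After normalization they are bounded
  -- at each A by the norm of A on Z, and the uniform bound obtained is linear in ‖A‖.
  let g : Z.Space → P.operators →L[𝕜] Z.Space := fun z => ((‖z‖⁻¹ : ℝ) : 𝕜) • orb z
  have hg : ∀ z A, ‖g z A‖ = ‖z‖⁻¹ * ‖orb z A‖ := fun z A => by
    change ‖((‖z‖⁻¹ : ℝ) : 𝕜) • orb z A‖ = _
    rw [norm_smul, RCLike.norm_ofReal, abs_inv, abs_norm]
  have hbs : ∀ A, ∃ C, ∀ z, ‖g z A‖ ≤ C := fun A => by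
    obtain ⟨S, hS, -⟩ := key A
    refine ⟨‖S‖, fun z => ?_⟩
    rw [hg, ← hS]
    by_cases hz : ‖z‖ = 0
    · simp [hz]
    · rw [inv_mul_le_iff₀ (by positivity), mul_comm]
      exact S.le_opNorm z
  obtain ⟨C, hC⟩ := banach_steinhaus (𝕜 := 𝕜) (𝕜₂ := 𝕜) (σ₁₂ := RingHom.id 𝕜) (E := P.operators) (F := Z.Space)
    (g := g) hbs
  refine ⟨|C| + 1, by positivity, fun A x y h => ?_⟩
  obtain ⟨S, hS, hS'⟩ := key A
  have hSn : ∀ z, ‖S z‖ ≤ (|C| + 1) * ‖A‖ * ‖z‖ := by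
    intro z
    by_cases hz : z = 0
    · simp [hz]
    have hz := norm_pos_iff.2 hz
    have h1 := ContinuousLinearMap.le_of_opNorm_le _ (hC z) A
    rw [hg, ← hS, inv_mul_le_iff₀ hz] at h1
    refine h1.trans ?_
    rw [mul_comm]
    gcongr
    exact (le_abs_self C).trans (by linarith)
  have := hSn (⟨_, h⟩ : Z.carrier)
  rwa [Z.nrm_eq_norm _ _ (hS' x y h).symm]

end BanachCouple

/-! ### Hahn–Banach extensions and closures of the intersection. -/

namespace BanachSubspace

variable {𝕜 E : Type*} [RCLike 𝕜] [AddCommGroup E] [Module 𝕜 E] (Z : BanachSubspace 𝕜 E)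

/-- Hahn-Banach extension from a subspace of `Z`. -/
theorem exists_extension {D : Submodule 𝕜 E} (hD : D ≤ Z.carrier) (f : Module.Dual 𝕜 D) {β : ℝ}
    (hβ : 0 ≤ β) (hf : ∀ d, ‖f d‖ ≤ β * Z.restrict hD d) :
    ∃ g : Z.Space →L[𝕜] 𝕜, ‖g‖ ≤ β ∧ ∀ z (hz : Z.incl z ∈ D), g z = f ⟨Z.incl z, hz⟩ := by
  let b : NNReal := ⟨β, hβ⟩
  let r : D.comap Z.incl →ₗ[𝕜] D := Z.incl.restrict fun _ h => h
  obtain ⟨g, hg, hgle⟩ := Module.Dual.exists_extension_of_le_seminorm (D.comap Z.incl) (f ∘ₗ r)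
    (p := b • normSeminorm 𝕜 Z.Space) fun x => hf (r x)
  refine ⟨g.mkContinuous β hgle, g.mkContinuous_norm_le hβ hgle, fun z hz => ?_⟩
  exact hg ⟨z, hz⟩

/-- The closure of `D` in `Z`. -/
noncomputable def closureOf (D : Submodule 𝕜 E) : Submodule 𝕜 E :=
  (D.comap Z.incl).topologicalClosure.map Z.incl

theorem closureOf_le (D : Submodule 𝕜 E) : Z.closureOf D ≤ Z.carrier := by
  rintro _ ⟨z, -, rfl⟩
  exact Z.incl_mem z

theorem le_closureOf {D : Submodule 𝕜 E} (hD : D ≤ Z.carrier) : D ≤ Z.closureOf D :=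
  fun d hd => ⟨(⟨d, hD hd⟩ : Z.carrier), Submodule.le_topologicalClosure _ hd, rfl⟩

theorem exists_functional_ne_zero {D : Submodule 𝕜 E} {z : Z.Space} (hz : Z.incl z ∉ Z.closureOf D) :
    ∃ g : Z.Space →L[𝕜] 𝕜, g z ≠ 0 ∧ ∀ d, Z.incl d ∈ D → g d = 0 := by
  let K := (D.comap Z.incl).topologicalClosure
  have hK : IsClosed (K : Set Z.Space) := Submodule.isClosed_topologicalClosure _
  have hzK : z ∉ K := fun h => hz ⟨z, h, rfl⟩
  have hne : K.mkQ z ≠ 0 := by simpa using hzK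
  obtain ⟨f, hf⟩ := SeparatingDual.exists_ne_zero (R := 𝕜) hne
  refine ⟨f.comp K.mkQL, hf, fun d hd => ?_⟩
  have : K.mkQ d = 0 := by
    simpa using Submodule.le_topologicalClosure (D.comap Z.incl) hd
  change f (K.mkQ d) = 0
  rw [this, map_zero]

/-- A sequence in D that converges in Z is Cauchy in Z', and both limits are the same element of the
Hausdorff space E. -/
theorem closureOf_mono [TopologicalSpace E] [T2Space E] {Z Z' : BanachSubspace 𝕜 E}
    (hZ : Continuous Z.incl) (hZ' : Continuous Z'.incl) {D : Submodule 𝕜 E} (h : D ≤ Z.carrier)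
    (h' : D ≤ Z'.carrier) (hd : (Z'.restrict h').Dominated (Z.restrict h)) :
    Z.closureOf D ≤ Z'.closureOf D := by
  rintro _ ⟨z, hz, rfl⟩
  obtain ⟨x, hx, hxz⟩ := mem_closure_iff_seq_limit.1 hz
  obtain ⟨C, hC, hd⟩ := hd.exists_pos
  let i : D →ₗ[𝕜] Z.Space := Submodule.inclusion h
  let i' : D →ₗ[𝕜] Z'.Space := Submodule.inclusion h'
  let d : ℕ → D := fun n => ⟨Z.incl (x n), hx n⟩
  have hid : ∀ n, i (d n) = x n := fun n => rfl
  have hle : ∀ m n, dist (i' (d m)) (i' (d n)) ≤ C * dist (x m) (x n) := fun m n => by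
    rw [dist_eq_norm, dist_eq_norm, ← hid, ← hid, ← map_sub, ← map_sub]
    exact hd _
  have hcau : CauchySeq fun n => i' (d n) := by
    refine Metric.cauchySeq_iff.2 fun ε hε => ?_
    obtain ⟨N, hN⟩ := Metric.cauchySeq_iff.1 hxz.cauchySeq (ε / C) (by positivity)
    refine ⟨N, fun m hm n hn => (hle m n).trans_lt ?_⟩
    have := hN m hm n hn
    rwa [lt_div_iff₀ hC, mul_comm] at this
  obtain ⟨v, hv⟩ := cauchySeq_tendsto_of_complete hcau
  have hzv : Z.incl z = Z'.incl v :=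
    tendsto_nhds_unique ((hZ.tendsto z).comp hxz) ((hZ'.tendsto v).comp hv)
  exact ⟨v, mem_closure_of_tendsto hv (.of_forall fun n => (d n).2), hzv.symm⟩

end BanachSubspace

/-! ### Rank one operators on a couple. -/

namespace BanachCouple

variable {𝕜 E : Type*} [RCLike 𝕜] [AddCommGroup E] [Module 𝕜 E]
variable (P : BanachCouple 𝕜 E) {Z : BanachSubspace 𝕜 E}

/-- f is extended to X and to Y separately by Hahn–Banach. The extensions agree on X ∩ Y ≤ D, so f ⊗
u is an operator on the couple and the uniform bound applies. -/
theorem rankOneBound [TopologicalSpace E] [T2Space E] [IsTopologicalAddGroup E]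
    (hX : Continuous P.X.incl) (hY : Continuous P.Y.incl) (hZ : Z ∈ P.interpolationSpaces)
    {D : Submodule 𝕜 E} (hDX : D ≤ P.X.carrier) (hDY : D ≤ P.Y.carrier) (hDZ : D ≤ Z.carrier)
    (hD : P.inter ≤ D) :
    (P.X.restrict hDX).RankOneBound (P.Y.restrict hDY) (Z.restrict hDZ) := by
  obtain ⟨C, hC, hbound⟩ := P.exists_uniform_bound hX hY hZ
  refine ⟨C, hC, fun f β₁ β₂ hβ₁ hβ₂ hf₁ hf₂ u w => ?_⟩
  obtain ⟨g₁, hg₁, hg₁f⟩ := P.X.exists_extension hDX f hβ₁ hf₁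
  obtain ⟨g₂, hg₂, hg₂f⟩ := P.Y.exists_extension hDY f hβ₂ hf₂
  let iX : D →ₗ[𝕜] P.X.Space := Submodule.inclusion hDX
  let iY : D →ₗ[𝕜] P.Y.Space := Submodule.inclusion hDY
  have hA : (g₁.smulRight (iX u), g₂.smulRight (iY u)) ∈ P.operators := by
    intro x y hxy
    have hx : P.X.incl x ∈ D := hD ⟨P.X.incl_mem x, hxy ▸ P.Y.incl_mem y⟩
    have hy : P.Y.incl y ∈ D := hxy ▸ hx
    have e : g₁ x = g₂ y := by
      rw [hg₁f x hx, hg₂f y hy]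
      congr 1
      exact Subtype.ext hxy
    change P.X.incl (g₁ x • iX u) = P.Y.incl (g₂ y • iY u)
    rw [map_smul, map_smul, e]
    rfl
  have hmem : P.X.incl (iX w) + P.Y.incl 0 ∈ Z.carrier := by
    rw [map_zero, add_zero]; exact hDZ w.2
  have hb := hbound ⟨_, hA⟩ (iX w) 0 hmem
  have hgw : g₁ (iX w) = f w := hg₁f (iX w) w.2
  have e1 : Z.nrm ⟨_, hmem⟩ = Z.restrict hDZ w := by
    rw [Z.restrict_apply]
    congr 1
    refine Subtype.ext ?_
    change P.X.incl (iX w) + P.Y.incl 0 = w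
    rw [map_zero, add_zero]; rfl
  have e2 : Z.nrm ⟨_, P.mem_of_operator hZ ⟨_, hA⟩ (iX w) 0 hmem⟩ =
      ‖f w‖ * Z.restrict hDZ u := by
    rw [← map_smul_eq_mul, Z.restrict_apply]
    congr 1
    refine Subtype.ext ?_
    change P.X.incl (g₁ (iX w) • iX u) + P.Y.incl (g₂ 0 • iY u) = f w • (u : E)
    rw [hgw, map_zero, zero_smul, map_zero, add_zero, map_smul]; rfl
  rw [e1, e2] at hb
  refine hb.trans ?_
  gcongr
  change max ‖g₁.smulRight (iX u)‖ ‖g₂.smulRight (iY u)‖ ≤ _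
  rw [ContinuousLinearMap.norm_smulRight_apply, ContinuousLinearMap.norm_smulRight_apply]
  refine max_le_max ?_ ?_
  · change _ ≤ β₁ * ‖iX u‖
    gcongr
  · change _ ≤ β₂ * ‖iY u‖
    gcongr

theorem controls [TopologicalSpace E] [T2Space E] [IsTopologicalAddGroup E]
    (hX : Continuous P.X.incl) (hY : Continuous P.Y.incl) {V W : BanachSubspace 𝕜 E}
    (hV : V ∈ P.interpolationSpaces) (hW : W ∈ P.interpolationSpaces)
    {D : Submodule 𝕜 E} (hDX : D ≤ P.X.carrier) (hDY : D ≤ P.Y.carrier) (hDV : D ≤ V.carrier)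
    (hDW : D ≤ W.carrier) (hD : P.inter ≤ D) :
    (P.X.restrict hDX).Controls (P.Y.restrict hDY) (V.restrict hDV) (W.restrict hDW) where
  pos₁ := P.X.restrict_pos hDX
  pos₂ := P.Y.restrict_pos hDY
  separated₁ := BanachSubspace.dualSeparated_restrict hX hY hDX hDY hD
  separated₂ := BanachSubspace.dualSeparated_restrict hY hX hDY hDX ((inf_comm P.Y.carrier P.X.carrier).trans_le hD)
  rankOne₁ := P.rankOneBound hX hY hV hDX hDY hDV hD
  rankOne₂ := P.rankOneBound hX hY hW hDX hDY hDW hD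
  le₁ := by
    obtain ⟨C, hC⟩ := hV.1.inter_bound
    exact ⟨C, fun u => hC ⟨u, hDX u.2, hDY u.2⟩⟩
  le₂ := by
    obtain ⟨C, hC⟩ := hW.1.inter_bound
    exact ⟨C, fun u => hC ⟨u, hDX u.2, hDY u.2⟩⟩

/-- An interpolation space which is not contained in `closure (X ∩ Y) + Y` contains `X`. -/
theorem X_le_or_le (hZ : Z ∈ P.interpolationSpaces) :
    P.X.carrier ≤ Z.carrier ∨ Z.carrier ≤ P.X.closureOf P.inter ⊔ P.Y.carrier := by
  refine or_iff_not_imp_right.2 fun h u hu => ?_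
  obtain ⟨z, hz, hz'⟩ := Set.not_subset.1 h
  obtain ⟨x, y, hxy⟩ := P.exists_add_eq (hZ.1.le_sum hz)
  have hx : P.X.incl x ∉ P.X.closureOf P.inter := fun hx =>
    hz' (hxy ▸ Submodule.add_mem_sup hx (P.Y.incl_mem y))
  obtain ⟨g, hgx, hg⟩ := P.X.exists_functional_ne_zero hx
  let u' : P.X.Space := (⟨u, hu⟩ : P.X.carrier)
  -- g vanishes on X ∩ Y, so g ⊗ u on X is compatible with 0 on Y. It sends z to g x • u with g x ≠
  -- 0, which puts u in Z.
  have hA : (g.smulRight u', 0) ∈ P.operators := by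
    intro x y hxy
    change P.X.incl (g x • u') = P.Y.incl 0
    rw [hg x ⟨P.X.incl_mem x, hxy ▸ P.Y.incl_mem y⟩, zero_smul, map_zero, map_zero]
  have := P.mem_of_operator hZ ⟨_, hA⟩ x y (hxy ▸ hz)
  change P.X.incl (g x • u') + P.Y.incl 0 ∈ Z.carrier at this
  rw [map_zero, add_zero, map_smul] at this
  exact (Submodule.smul_mem_iff _ hgx).1 this

/-- An interpolation space which is not contained in `X + closure (X ∩ Y)` contains `Y`. -/
theorem Y_le_or_le (hZ : Z ∈ P.interpolationSpaces) :
    P.Y.carrier ≤ Z.carrier ∨ Z.carrier ≤ P.X.carrier ⊔ P.Y.closureOf P.inter := by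
  refine or_iff_not_imp_right.2 fun h u hu => ?_
  obtain ⟨z, hz, hz'⟩ := Set.not_subset.1 h
  obtain ⟨x, y, hxy⟩ := P.exists_add_eq (hZ.1.le_sum hz)
  have hy : P.Y.incl y ∉ P.Y.closureOf P.inter := fun hy =>
    hz' (hxy ▸ Submodule.add_mem_sup (P.X.incl_mem x) hy)
  obtain ⟨g, hgy, hg⟩ := P.Y.exists_functional_ne_zero hy
  let u' : P.Y.Space := (⟨u, hu⟩ : P.Y.carrier)
  have hA : (0, g.smulRight u') ∈ P.operators := by
    intro x y hxy
    change P.X.incl 0 = P.Y.incl (g y • u')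
    rw [hg y ⟨hxy ▸ P.X.incl_mem x, P.Y.incl_mem y⟩, zero_smul, map_zero, map_zero]
  have := P.mem_of_operator hZ ⟨_, hA⟩ x y (hxy ▸ hz)
  change P.X.incl 0 + P.Y.incl (g y • u') ∈ Z.carrier at this
  rw [map_zero, zero_add, map_smul] at this
  exact (Submodule.smul_mem_iff _ hgy).1 this

end BanachCouple

/-! ### Identification of the couples in a modular lattice. -/

section Lattice

variable {α : Type*} [Lattice α]

theorem le_of_le_sup_of_inf_le [IsModularLattice α] {a x y x₀ : α} (h₀ : x₀ ≤ x) (hxy : x ⊓ y ≤ x₀) (ha : a ≤ x)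
    (h : a ≤ x₀ ⊔ y) : a ≤ x₀ :=
  calc a ≤ (x₀ ⊔ y) ⊓ x := le_inf h ha
    _ = x₀ ⊔ y ⊓ x := sup_inf_assoc_of_le y h₀
    _ ≤ x₀ := sup_le le_rfl (inf_comm x y ▸ hxy)

/-- The order relations between two couples `(x, y)` and `(v, w)` with the same intersection `d`
and the same sum, `x₀` and `y₀` being the closures of `d` in `x` and `v`, and in `y` and `w`. -/
structure CoupleRelations (x y v w x₀ y₀ d : α) : Prop where
  inf_xy : x ⊓ y = d
  inf_vw : v ⊓ w = d
  sup_eq : x ⊔ y = v ⊔ w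
  d_le_x₀ : d ≤ x₀
  d_le_y₀ : d ≤ y₀
  x₀_le_x : x₀ ≤ x
  x₀_le_v : x₀ ≤ v
  y₀_le_y : y₀ ≤ y
  y₀_le_w : y₀ ≤ w
  xv : x ≤ v ∨ v ≤ x₀ ⊔ y
  xw : x ≤ w ∨ w ≤ x₀ ⊔ y
  yv : y ≤ v ∨ v ≤ x ⊔ y₀
  yw : y ≤ w ∨ w ≤ x ⊔ y₀
  vx : v ≤ x ∨ x ≤ x₀ ⊔ w
  vy : v ≤ y ∨ y ≤ x₀ ⊔ w
  wx : w ≤ x ∨ x ≤ v ⊔ y₀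
  wy : w ≤ y ∨ y ≤ v ⊔ y₀

namespace CoupleRelations

variable {x y v w x₀ y₀ d : α}

theorem symm (h : CoupleRelations x y v w x₀ y₀ d) : CoupleRelations v w x y x₀ y₀ d :=
  ⟨h.inf_vw, h.inf_xy, h.sup_eq.symm, h.d_le_x₀, h.d_le_y₀, h.x₀_le_v, h.x₀_le_x, h.y₀_le_w,
    h.y₀_le_y, h.vx, h.vy, h.wx, h.wy, h.xv, h.xw, h.yv, h.yw⟩

theorem swap (h : CoupleRelations x y v w x₀ y₀ d) : CoupleRelations y x w v y₀ x₀ d where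
  inf_xy := inf_comm x y ▸ h.inf_xy
  inf_vw := inf_comm v w ▸ h.inf_vw
  sup_eq := by rw [sup_comm, h.sup_eq, sup_comm]
  d_le_x₀ := h.d_le_y₀
  d_le_y₀ := h.d_le_x₀
  x₀_le_x := h.y₀_le_y
  x₀_le_v := h.y₀_le_w
  y₀_le_y := h.x₀_le_x
  y₀_le_w := h.x₀_le_v
  xv := sup_comm x y₀ ▸ h.yw
  xw := sup_comm x y₀ ▸ h.yv
  yv := sup_comm x₀ y ▸ h.xw
  yw := sup_comm x₀ y ▸ h.xv
  vx := sup_comm v y₀ ▸ h.wy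
  vy := sup_comm v y₀ ▸ h.wx
  wx := sup_comm x₀ w ▸ h.vy
  wy := sup_comm x₀ w ▸ h.vx

/-- Exchanging only v and w is legitimate once both closures equal d, since x₀ must lie below the
partner of x. -/
theorem swapRight (h : CoupleRelations x y v w d d d) : CoupleRelations x y w v d d d where
  inf_xy := h.inf_xy
  inf_vw := inf_comm v w ▸ h.inf_vw
  sup_eq := by rw [h.sup_eq, sup_comm]
  d_le_x₀ := le_rfl
  d_le_y₀ := le_rfl
  x₀_le_x := h.x₀_le_x
  x₀_le_v := h.y₀_le_w
  y₀_le_y := h.y₀_le_y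
  y₀_le_w := h.x₀_le_v
  xv := h.xw
  xw := h.xv
  yv := h.yw
  yw := h.yv
  vx := sup_comm v d ▸ h.wx
  vy := sup_comm v d ▸ h.wy
  wx := sup_comm d w ▸ h.vx
  wy := sup_comm d w ▸ h.vy

variable [IsModularLattice α]

/-- If v ≤ x failed, then v ≤ y would put x below d, and otherwise v ≤ x₀ ⊔ w, so v ≤ x₀ by
modularity; both contradict `hx`. With x = v, the elements y ≤ w have the same meet and join with x,
hence coincide. -/
theorem eq_of_le (h : CoupleRelations x y v w x₀ y₀ d) (hx : ¬ x ≤ x₀) (hxv : x ≤ v) :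
    x = v ∧ y = w := by
  have hxy : ¬ x ≤ y := fun hle => hx ((le_inf le_rfl hle).trans (h.inf_xy.trans_le h.d_le_x₀))
  have hvx : v ≤ x := by
    rcases h.vx with h1 | h1
    · exact h1
    rcases h.vy with h2 | h2
    · exact absurd (hxv.trans h2) hxy
    · have h3 : v ≤ x₀ ⊔ w := le_sup_left.trans (h.sup_eq.symm.trans_le (sup_le h1 h2))
      have h4 := le_of_le_sup_of_inf_le h.x₀_le_v (h.inf_vw.trans_le h.d_le_x₀) le_rfl h3
      exact absurd (hxv.trans h4) hx
  obtain rfl := le_antisymm hxv hvx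
  refine ⟨rfl, ?_⟩
  have hyw : y ≤ w := by
    by_cases hy : y ≤ y₀
    · exact hy.trans h.y₀_le_w
    rcases h.yw with h1 | h1
    · exact h1
    have h2 : y ≤ y₀ ⊔ x := by
      rw [sup_comm]
      exact le_sup_right.trans (h.sup_eq.trans_le (sup_le le_sup_left h1))
    exact absurd (le_of_le_sup_of_inf_le h.y₀_le_y
      ((inf_comm y x).trans_le (h.inf_xy.trans_le h.d_le_y₀)) le_rfl h2) hy
  refine eq_of_le_of_inf_le_of_sup_le (z := x) hyw ?_ ?_
  · rw [inf_comm, h.inf_vw, inf_comm, h.inf_xy]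
  · rw [sup_comm, ← h.sup_eq, sup_comm]

/-- x lies below v or w, as otherwise v ⊔ w ≤ x₀ ⊔ y and modularity gives x ≤ x₀. If x ≤ w but not x
≤ v, both closures collapse to d and `swapRight` reduces to `eq_of_le`. -/
theorem eq_or_eq_of_not_le (h : CoupleRelations x y v w x₀ y₀ d) (hx : ¬ x ≤ x₀) :
    (x = v ∧ y = w) ∨ (x = w ∧ y = v) := by
  by_cases hxv : x ≤ v
  · exact .inl (h.eq_of_le hx hxv)
  have hxy : ¬ x ≤ y := fun hle => hx ((le_inf le_rfl hle).trans (h.inf_xy.trans_le h.d_le_x₀))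
  have hvsup := h.xv.resolve_left hxv
  have hxw : x ≤ w := by
    by_contra hxw
    have h1 : x ≤ x₀ ⊔ y :=
      le_sup_left.trans (h.sup_eq.trans_le (sup_le hvsup (h.xw.resolve_left hxw)))
    exact hx (le_of_le_sup_of_inf_le h.x₀_le_x (h.inf_xy.trans_le h.d_le_x₀) le_rfl h1)
  obtain rfl : x₀ = d := le_antisymm
    (h.inf_vw ▸ le_inf h.x₀_le_v (h.x₀_le_x.trans hxw)) h.d_le_x₀
  have hwx : w ≤ x := by
    rcases h.wx with h1 | h1
    · exact h1
    rcases h.wy with h2 | h2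
    · exact absurd (hxw.trans h2) hxy
    · have h3 : w ≤ y₀ ⊔ v := by
        rw [sup_comm]
        exact le_sup_right.trans (h.sup_eq.symm.trans_le (sup_le h1 h2))
      have h4 := le_of_le_sup_of_inf_le h.y₀_le_w
        ((inf_comm w v).trans_le (h.inf_vw.trans_le h.d_le_y₀)) le_rfl h3
      exact absurd ((hxw.trans h4).trans h.y₀_le_y) hxy
  obtain rfl : y₀ = x₀ := le_antisymm
    (h.inf_xy ▸ le_inf (h.y₀_le_w.trans hwx) h.y₀_le_y) h.d_le_y₀
  exact .inr (h.swapRight.eq_of_le hx hxw)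

/-- If one of the four elements exceeds its closure, a symmetry moves it to the position of x.
Otherwise x = x₀ = v and y = y₀ = w. -/
theorem eq_or_eq (h : CoupleRelations x y v w x₀ y₀ d) :
    (x = v ∧ y = w) ∨ (x = w ∧ y = v) := by
  by_cases hx : x ≤ x₀
  swap
  · exact h.eq_or_eq_of_not_le hx
  by_cases hy : y ≤ y₀
  swap
  · exact (h.swap.eq_or_eq_of_not_le hy).imp And.symm And.symm
  by_cases hv : v ≤ x₀
  swap
  · exact (h.symm.eq_or_eq_of_not_le hv).imp (fun e => ⟨e.1.symm, e.2.symm⟩)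
      fun e => ⟨e.2.symm, e.1.symm⟩
  by_cases hw : w ≤ y₀
  swap
  · exact (h.symm.swap.eq_or_eq_of_not_le hw).imp (fun e => ⟨e.2.symm, e.1.symm⟩)
      fun e => ⟨e.1.symm, e.2.symm⟩
  exact .inl ⟨le_antisymm (hx.trans h.x₀_le_v) (hv.trans h.x₀_le_x),
    le_antisymm (hy.trans h.y₀_le_w) (hw.trans h.y₀_le_y)⟩

end CoupleRelations

end Lattice

/-! ### Conclusion. -/

namespace BanachCouple

variable {𝕜 E : Type*} [RCLike 𝕜] [AddCommGroup E] [Module 𝕜 E] {P Q : BanachCouple 𝕜 E}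

theorem inter_le_of_interpolationSpaces_eq (h : P.interpolationSpaces = Q.interpolationSpaces) :
    P.inter ≤ Q.inter :=
  le_inf (h ▸ Q.X_mem : Q.X ∈ P.interpolationSpaces).1.inter_le
    (h ▸ Q.Y_mem : Q.Y ∈ P.interpolationSpaces).1.inter_le

theorem sum_le_of_interpolationSpaces_eq (h : P.interpolationSpaces = Q.interpolationSpaces) :
    Q.sum ≤ P.sum :=
  sup_le (h ▸ Q.X_mem : Q.X ∈ P.interpolationSpaces).1.le_sum
    (h ▸ Q.Y_mem : Q.Y ∈ P.interpolationSpaces).1.le_sum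

end BanachCouple

theorem corollary2p9 {𝕜 E : Type*} [RCLike 𝕜] [AddCommGroup E] [Module 𝕜 E]
    (P Q : BanachCouple 𝕜 E) (h : P.interpolationSpaces = Q.interpolationSpaces) :
    P.Equivalent Q := by
  obtain ⟨τ, _, _, -, hX, hY⟩ := P.exists_hausdorff_vector_topology
  replace hX : Continuous P.X.incl := hX
  replace hY : Continuous P.Y.incl := hY
  have mV : Q.X ∈ P.interpolationSpaces := h ▸ Q.X_mem
  have mW : Q.Y ∈ P.interpolationSpaces := h ▸ Q.Y_mem
  have mX : P.X ∈ Q.interpolationSpaces := h ▸ P.X_mem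
  have mY : P.Y ∈ Q.interpolationSpaces := h ▸ P.Y_mem
  -- The topology of the first couple serves both: V and W are intermediate spaces for it, hence
  -- embed continuously.
  have hV : Continuous Q.X.incl := P.continuous_incl hX hY mV.1
  have hW : Continuous Q.Y.incl := P.continuous_incl hX hY mW.1
  have hinter : Q.inter = P.inter := le_antisymm
    (BanachCouple.inter_le_of_interpolationSpaces_eq h.symm)
    (BanachCouple.inter_le_of_interpolationSpaces_eq h)
  have hsum : P.sum = Q.sum := le_antisymm
    (BanachCouple.sum_le_of_interpolationSpaces_eq h.symm)
    (BanachCouple.sum_le_of_interpolationSpaces_eq h)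
  have dX : P.inter ≤ P.X.carrier := inf_le_left
  have dY : P.inter ≤ P.Y.carrier := inf_le_right
  have dV : P.inter ≤ Q.X.carrier := hinter ▸ inf_le_left
  have dW : P.inter ≤ Q.Y.carrier := hinter ▸ inf_le_right
  have hac := P.controls hX hY mV mW dX dY dV dW le_rfl
  have hca := Q.controls hV hW mX mY dV dW dX dY hinter.le
  have vX := Q.X_le_or_le mX
  have vY := Q.X_le_or_le mY
  have wX := Q.Y_le_or_le mX
  have wY := Q.Y_le_or_le mY
  rw [hinter] at vX vY wX wY
  have hcarrier : (P.X.carrier = Q.X.carrier ∧ P.Y.carrier = Q.Y.carrier) ∨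
      (P.X.carrier = Q.Y.carrier ∧ P.Y.carrier = Q.X.carrier) := by
    rcases hac.equivalent_or_equivalent hca with ⟨⟨h1, h2⟩, h3, h4⟩ | ⟨⟨h1, h2⟩, h3, h4⟩
    · have e1 : Q.X.closureOf P.inter = P.X.closureOf P.inter := le_antisymm
        (BanachSubspace.closureOf_mono hV hX dV dX h1) (BanachSubspace.closureOf_mono hX hV dX dV h2)
      have e2 : Q.Y.closureOf P.inter = P.Y.closureOf P.inter := le_antisymm
        (BanachSubspace.closureOf_mono hW hY dW dY h3) (BanachSubspace.closureOf_mono hY hW dY dW h4)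
      rw [e1] at vX vY
      rw [e2] at wX wY
      exact CoupleRelations.eq_or_eq (x₀ := P.X.closureOf P.inter) (y₀ := P.Y.closureOf P.inter)
        (d := P.inter)
        ⟨rfl, hinter, hsum, P.X.le_closureOf dX, P.Y.le_closureOf dY, P.X.closureOf_le _,
          e1 ▸ Q.X.closureOf_le _, P.Y.closureOf_le _, e2 ▸ Q.Y.closureOf_le _,
          P.X_le_or_le mV, P.X_le_or_le mW, P.Y_le_or_le mV, P.Y_le_or_le mW, vX, vY, wX, wY⟩
    -- Here the norms match crosswise, so the lattice argument is run with V and W exchanged.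
    · have e1 : Q.Y.closureOf P.inter = P.X.closureOf P.inter := le_antisymm
        (BanachSubspace.closureOf_mono hW hX dW dX h1) (BanachSubspace.closureOf_mono hX hW dX dW h2)
      have e2 : Q.X.closureOf P.inter = P.Y.closureOf P.inter := le_antisymm
        (BanachSubspace.closureOf_mono hV hY dV dY h3) (BanachSubspace.closureOf_mono hY hV dY dV h4)
      rw [e2, sup_comm] at vX vY
      rw [e1, sup_comm] at wX wY
      exact (CoupleRelations.eq_or_eq (x₀ := P.X.closureOf P.inter) (y₀ := P.Y.closureOf P.inter)
        (d := P.inter)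
        ⟨rfl, (inf_comm _ _).trans hinter, hsum.trans (sup_comm _ _), P.X.le_closureOf dX,
          P.Y.le_closureOf dY, P.X.closureOf_le _, e1 ▸ Q.Y.closureOf_le _, P.Y.closureOf_le _,
          e2 ▸ Q.X.closureOf_le _, P.X_le_or_le mW, P.X_le_or_le mV, P.Y_le_or_le mW,
          P.Y_le_or_le mV, wX, wY, vX, vY⟩).symm
  refine hcarrier.imp (fun e => ⟨?_, ?_⟩) fun e => ⟨?_, ?_⟩
  · exact BanachSubspace.equivalent_of_carrier_eq hX hV e.1
  · exact BanachSubspace.equivalent_of_carrier_eq hY hW e.2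
  · exact BanachSubspace.equivalent_of_carrier_eq hX hW e.1
  · exact BanachSubspace.equivalent_of_carrier_eq hY hV e.2
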